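/- Let $(W,S)$ be a Coxeter system with $S$ finite and orders $m_{st}\in\mathbb N_{\ge 1}\cup\{\infty\}$. Let $V$ be a real vector space with a symmetric bilinear form $(\,,\,)$ and a basis $\Pi=\{\alpha_s\mid s\in S\}$ such that $(\alpha_s,\alpha_s)=1$ for all $s$ and, for $s\neq t$, $(\alpha_s,\alpha_t)=-\cos(\pi/m_{st})$ if $m_{st}<\infty$ and $(\alpha_s,\alpha_t)\le -1$ if $m_{st}=\infty$. Let $W$ act linearly on $V$ by letting $s\in S$ act as $v\mapsto v-2(\alpha_s,v)\alpha_s$. Let $\varphi\colon V\to\mathbb R$ be the sum of the coordinates in the basis $\Pi$, put $V_1=\{\varphi=1\}$, $\widehat v=v/\varphi(v)$ if $\varphi(v)\ne0$, $\widehat X=\{\widehat v\mid v\in X,\ \varphi(v)\neq 0\}$, and $w\cdot x=\widehat{wx}$. Let $\mathcal K$ be the set of all $v=\sum_s\lambda_s\alpha_s$ with all $\lambda_s\ge0$, not all zero, and $(v,\alpha_s)\le0$ for all $s\in S$. Let $\mathcal Z=\bigcup_{w\in W}w\mathcal K$ be the imaginary cone and $Z=\widehat{\mathcal Z}\subseteq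 V_1$. A subset $T\subseteq S$ is spherical if $W_T=\langle T\rangle$ is finite. Let $K_\Sigma$ be the geometric realisation of the poset of spherical subsets, with vertices $u_T$; let $K_s$ be the union of the simplices of $K_\Sigma$ whose smallest vertex is $u_{\{s\}}$. The Davis complex $\Sigma$ is the quotient of $W\times K_\Sigma$ ($W$ discrete) by the relation $(w,k)\sim(w',k')$ iff $k=k'$ and $w^{-1}w'\in\langle s\in S\mid k\in K_s\rangle$; $W$ acts on it by $w[w',k]=[ww',k]$. **Theorem.** Let $v_0$ be a point of the interior of $\widehat{\mathcal K}$ in $V_1$. For spherical $T$ let $v_T\in V_1$ be the normalised average of the $W_T$-orbit of $v_0$, $$v_T=\widehat{c_T},\qquad c_T=\frac1{|W_T|}\sum_{g\in W_T}g\,v_0 .$$ Let $F\colon K_\Sigma\to V$ be the map with $F(u_T)=v_T$ that is affine on each simplex. Then $F([w,k])=w\cdot F(k)$ is a well-defined map $F\colon\Sigma\to Z$, it is $W$-equivariant (that is, $F(wx)=w\cdot F(x)$ for all $w\in W$ and $x\in\Sigma$), and it is an embedding: it is injective and a homeomorphism onto its image. -/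

import Mathlib

open Set Topology

/-! ### Spherical subsets, the Davis chamber and the Davis complex of a Coxeter system -/

namespace CoxeterSystem

variable {B W : Type*} [Group W] {M : CoxeterMatrix B} (cs : CoxeterSystem M W)

/-- The standard parabolic subgroup `W_T` generated by the simple reflections indexed by `T`. -/
def parabolic (T : Set B) : Subgroup W := Subgroup.closure (cs.simple '' T)

/-- The poset (under inclusion) of spherical subsets: those `T` for which `W_T` is finite. -/
abbrev Spherical : Type _ := {T : Set B // Finite (cs.parabolic T)}

noncomputable instance [Finite B] : Fintype cs.Spherical := Fintype.ofFinite _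

instance (T : cs.Spherical) : Finite (cs.parabolic T.1) := T.2

/-- The chamber `K_Σ`: the geometric realisation of the (finite) poset of spherical subsets.
A point is given by its barycentric coordinates, which are supported on a chain; the topology is
that of a finite simplicial complex, induced from the product topology on coordinates. -/
abbrev Chamber [Finite B] : Type _ :=
  {k : cs.Spherical → ℝ // k ∈ stdSimplex ℝ cs.Spherical ∧ IsChain (· ≤ ·) (Function.support k)}

variable {cs} in
/-- The mirror `K_s`: the union of those simplices (chains of spherical subsets) that have `{s}`
as minimal element. A point lies in the closed simplex spanned by `c` iff its barycentric
coordinates vanish outside `c`. -/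
def mirror [Finite B] (s : B) : Set cs.Chamber :=
  {k | ∃ c : Set cs.Spherical, IsChain (· ≤ ·) c ∧
    (∃ T ∈ c, T.1 = {s} ∧ ∀ T' ∈ c, T ≤ T') ∧ Function.support k.1 ⊆ c}

/-- The subgroup `W_k` generated by the simple reflections whose mirrors contain `k`. -/
def isotropy [Finite B] (k : cs.Chamber) : Subgroup W :=
  cs.parabolic {s | k ∈ mirror s}

/-- The relation `(w, k) ∼ (w', k')` iff `k = k'` and `w⁻¹ w' ∈ W_k`. -/
def davisSetoid [Finite B] : Setoid (W × cs.Chamber) where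
  r p q := p.2 = q.2 ∧ p.1⁻¹ * q.1 ∈ cs.isotropy p.2
  iseqv :=
    { refl := fun p => ⟨rfl, by simp⟩
      symm := by
        rintro ⟨w, k⟩ ⟨w', k'⟩ ⟨rfl, h⟩
        exact ⟨rfl, by simpa using inv_mem h⟩
      trans := by
        rintro ⟨w, k⟩ ⟨w', k'⟩ ⟨w'', k''⟩ ⟨rfl, h⟩ ⟨h', h''⟩
        obtain rfl : k = k'' := h'
        exact ⟨rfl, by simpa [mul_assoc] using mul_mem h h''⟩ }

/-- The Davis complex `Σ`. -/
def Davis [Finite B] : Type _ := Quotient cs.davisSetoid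

/-- The class `[w, k]` in the Davis complex. -/
def davisMk [Finite B] (w : W) (k : cs.Chamber) : cs.Davis := Quotient.mk cs.davisSetoid (w, k)

/-- The quotient topology of `W × K_Σ`, with `W` discrete. -/
instance [Finite B] : TopologicalSpace cs.Davis :=
  letI : TopologicalSpace W := ⊥
  inferInstanceAs (TopologicalSpace (Quotient cs.davisSetoid))

/-- `W` acts on the Davis complex by `w • [w', k] = [w w', k]`. -/
instance [Finite B] : MulAction W cs.Davis where
  smul w := Quotient.map (fun p => (w * p.1, p.2)) (by
    rintro ⟨a, k⟩ ⟨b, k'⟩ ⟨rfl, h⟩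
    exact ⟨rfl, by simpa [mul_assoc] using h⟩)
  one_smul := by
    rintro ⟨w, k⟩
    exact congrArg (Quotient.mk cs.davisSetoid) (by simp)
  mul_smul := by
    rintro a b ⟨w, k⟩
    exact congrArg (Quotient.mk cs.davisSetoid) (by simp [mul_assoc])

theorem smul_davisMk [Finite B] (w w' : W) (k : cs.Chamber) :
    w • cs.davisMk w' k = cs.davisMk (w * w') k := rfl

end CoxeterSystem

/-! ### Coxeter data and the imaginary cone -/

/-- A Coxeter datum `(V, Π, ( , ))` for the Coxeter matrix `M` (with entry `0` standing for `∞`)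
whose set `Π` of simple roots is a basis of `V`. (The positive independence `0 ∉ PLC(Π)` required
of a general root basis is then automatic, see `CoxeterDatum.zero_notMem_plc`.) -/
structure CoxeterDatum {B : Type*} (M : CoxeterMatrix B) (V : Type*) [AddCommGroup V]
    [Module ℝ V] where
  /-- the simple roots `α_s` -/
  root : Module.Basis B ℝ V
  /-- the bilinear form -/
  form : LinearMap.BilinForm ℝ V
  form_symm : ∀ x y, form x y = form y x
  form_root_self : ∀ s, form (root s) (root s) = 1
  form_root_of_ne_zero : ∀ s t, s ≠ t → M s t ≠ 0 →
    form (root s) (root t) = -Real.cos (Real.pi / M s t)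
  form_root_of_eq_zero : ∀ s t, s ≠ t → M s t = 0 → form (root s) (root t) ≤ -1

namespace CoxeterDatum

variable {B W V : Type*} [Group W] [AddCommGroup V] [Module ℝ V]
  {M : CoxeterMatrix B} (D : CoxeterDatum M V) (cs : CoxeterSystem M W)

/-- The reflection `ρ_s v = v - 2 (α_s, v) α_s`; recall `(α_s, α_s) = 1`. -/
noncomputable def reflection (s : B) : V ≃ₗ[ℝ] V :=
  Module.reflection (x := D.root s) (f := (2 : ℝ) • D.form (D.root s))
    (by simp [D.form_root_self])

theorem reflection_apply (s : B) (v : V) :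
    D.reflection s v = v - (2 * D.form (D.root s) v) • D.root s := by
  simp [reflection, Module.reflection_apply]

/-- The reflections `ρ_s` satisfy the defining relations of the Coxeter group. -/
theorem isLiftable_reflection : M.IsLiftable D.reflection := by
  intro s t
  by_cases hst : s = t
  · subst hst
    ext v
    simp [D.reflection_apply, D.form_root_self]
    module
  by_cases h0 : M s t = 0
  · simp [h0]
  have h1 : M s t ≠ 1 := M.off_diagonal s t hst
  have hf := D.form_root_of_ne_zero s t hst h0
  generalize hm : M s t = m at h0 h1 hf ⊢
  have hf' : D.form (D.root t) (D.root s) = -Real.cos (Real.pi / m) := by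
    rw [D.form_symm, hf]
  by_cases h2 : m = 2
  · subst h2
    have e : D.form (D.root s) (D.root t) = 0 := by rw [hf]; simp
    have e' : D.form (D.root t) (D.root s) = 0 := by rw [hf']; simp
    ext v
    simp only [pow_two, LinearEquiv.mul_apply, D.reflection_apply, map_sub, map_smul,
      smul_eq_mul, e, e', D.form_root_self, LinearEquiv.coe_one, id_eq]
    module
  have hm3 : (3 : ℝ) ≤ m := by
    have : 3 ≤ m := by omega
    exact_mod_cast this
  have hmpos : (0 : ℝ) < m := by linarith
  set θ : ℝ := 2 * Real.pi / m with hθ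
  have hsin : Real.sin θ ≠ 0 := by
    refine (Real.sin_pos_of_pos_of_lt_pi (by positivity) ?_).ne'
    rw [hθ, div_lt_iff₀ hmpos]
    nlinarith [Real.pi_pos]
  have ht : (2 * Real.cos θ : ℝ) = ((2 : ℝ) • D.form (D.root s)) (D.root t) *
      ((2 : ℝ) • D.form (D.root t)) (D.root s) - 2 := by
    have : θ = 2 * (Real.pi / m) := by rw [hθ]; ring
    simp only [LinearMap.smul_apply, smul_eq_mul, hf, hf', this, Real.cos_two_mul]
    ring
  have hS := Polynomial.Chebyshev.S_two_mul_real_cos (θ := θ)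
  have hmθ : m * θ = 2 * Real.pi := by rw [hθ]; field_simp
  have hsum : ∀ a b : ℤ, a + b + 2 = m →
      (Polynomial.Chebyshev.S ℝ a).eval (2 * Real.cos θ) +
        (Polynomial.Chebyshev.S ℝ b).eval (2 * Real.cos θ) = 0 := by
    intro a b hab
    have hb : ((b : ℝ) + 1) * θ = 2 * Real.pi - (a + 1) * θ := by
      rw [← hmθ]
      have : (m : ℝ) = a + b + 2 := by exact_mod_cast hab.symm
      rw [this]; ring
    apply mul_right_cancel₀ hsin
    rw [add_mul, hS, hS, hb, Real.sin_two_pi_sub]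
    ring
  have hself : ∀ a : ℤ, 2 * a + 2 = m →
      (Polynomial.Chebyshev.S ℝ a).eval (2 * Real.cos θ) = 0 := by
    intro a ha
    have := hsum a a (by omega)
    linarith
  ext v
  rw [reflection, reflection, Module.reflection_mul_reflection_pow_apply _ _ m v _ ht]
  rcases Nat.even_or_odd' m with ⟨j, hj | hj⟩
  · have e1 : ((m : ℤ) - 2) / 2 = j - 1 := by omega
    have e2 : ((m : ℤ) - 1) / 2 = j - 1 := by omega
    rw [e1, e2, hself (j - 1) (by omega)]
    simp
  · have e1 : ((m : ℤ) - 1) / 2 = j := by omega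
    have e2 : ((m : ℤ) - 3) / 2 = j - 1 := by omega
    have e3 : (m : ℤ) / 2 = j := by omega
    have e4 : ((m : ℤ) - 2) / 2 = j - 1 := by omega
    rw [e1, e2, e3, e4, hsum j (j - 1) (by omega)]
    simp

/-- The linear action of `W` on `V`: the homomorphism with `r_s ↦ ρ_s`. -/
noncomputable def rep : W →* (V ≃ₗ[ℝ] V) := cs.lift ⟨D.reflection, D.isLiftable_reflection⟩

theorem rep_simple (s : B) : D.rep cs (cs.simple s) = D.reflection s :=
  cs.lift_apply_simple D.isLiftable_reflection s

section Finite

variable [Fintype B]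

/-- `PLC(Π)`: the linear combinations of simple roots with nonnegative coefficients, not all
zero. -/
def plc : Set V :=
  {v | ∃ c : B → ℝ, (∀ s, 0 ≤ c s) ∧ (∃ s, 0 < c s) ∧ v = ∑ s, c s • D.root s}

theorem zero_notMem_plc : (0 : V) ∉ D.plc := by
  rintro ⟨c, -, ⟨s, hs⟩, h⟩
  have := (Fintype.linearIndependent_iff.1 D.root.linearIndependent) c h.symm s
  exact hs.ne' this

/-- The linear form `φ`: the sum of the coordinates in the basis of simple roots. -/
noncomputable def height : V →ₗ[ℝ] ℝ := ∑ s, D.root.coord s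

/-- The transverse hyperplane `V₁ = {φ = 1}`. -/
def V₁ : Set V := {v | D.height v = 1}

/-- The parallel hyperplane `V₀ = {φ = 0}` through the origin. -/
def V₀ : Set V := {v | D.height v = 0}

/-- The normalisation map `v ↦ v̂ = v / φ(v)`, meaningful for `v ∉ V₀`. -/
noncomputable def normalize (v : V) : V := (D.height v)⁻¹ • v

/-- The normalisation `X̂` of a set `X`. Points of `V₀` have no normalisation. -/
def hat (X : Set V) : Set V := D.normalize '' (X \ D.V₀)

theorem hat_subset (X : Set V) : D.hat X ⊆ D.V₁ := by
  rintro _ ⟨v, ⟨-, hv⟩, rfl⟩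
  have hv' : D.height v ≠ 0 := hv
  simp [V₁, normalize, hv']

/-- The normalised action `w · x`, the normalisation of `w x`. -/
noncomputable def dot (w : W) (x : V) : V := D.normalize (D.rep cs w x)

/-- The cone `𝒦 = {v ∈ PLC(Π) | (v, a) ≤ 0 for all a ∈ Π}`. -/
def coneK : Set V := {v | v ∈ D.plc ∧ ∀ s, D.form v (D.root s) ≤ 0}

/-- The imaginary cone `𝒵 = ⋃ w 𝒦`. -/
def imaginaryCone : Set V := ⋃ w : W, D.rep cs w '' D.coneK

/-- The normalised fundamental chamber `𝒦̂`. -/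
def chamberK : Set V := D.hat D.coneK

/-- The normalised imaginary cone `Z`. -/
def Z : Set V := D.hat (D.imaginaryCone cs)

/-- The interior of `𝒦̂` as a subset of the hyperplane `V₁`. -/
def interiorK [TopologicalSpace V] : Set V :=
  (↑) '' interior {x : D.V₁ | (x : V) ∈ D.chamberK}

/-- The point `v_T ∈ V₁`: the average `|W_T|⁻¹ ∑_{g ∈ W_T} g v₀` of the `W_T`-orbit of `v₀`,
normalised. -/
noncomputable def vertexImage (v₀ : V) (T : cs.Spherical) : V :=
  D.normalize ((Nat.card (cs.parabolic T.1) : ℝ)⁻¹ •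
    ∑ᶠ g : cs.parabolic T.1, D.rep cs (g : W) v₀)

/-- The map on the chamber `K_Σ` sending the vertex `u_T` to `v_T` and affine on each simplex. -/
noncomputable def chamberMap (v₀ : V) (k : cs.Chamber) : V :=
  ∑ T : cs.Spherical, k.1 T • D.vertexImage cs v₀ T

end Finite

end CoxeterDatum

/-!
The points of the image of the chamber `K_Σ` are positive combinations of the vertices `v_T`, and
everything rests on the products of the `v_T` with the simple roots: `(v_T, α_s) = 0` for `s ∈ T`
because `c_T` is fixed by `W_T`, and `(v_T, α_s) < 0` for `s ∉ T` because `c_T - v₀` is a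
nonnegative combination of the simple roots in `T` while `(v₀, α_s) < 0` at an interior point `v₀`.
Hence `F(K_Σ) ⊆ 𝒦`, and the simple roots orthogonal to `F(k)` are those with `k ∈ K_s`
(`form_chamberMap_eq_zero_iff`, `mem_mirror_iff`). They form the smallest member of the chain
supporting `k`, which allows the barycentric coordinates of `k` to be read off from `F(k)` one
vertex at a time (`chamberMap_injective`).

The input from the theory of Coxeter groups is the positivity of roots: `w α_s` is a nonnegative
combination of simple roots unless `s` is a right descent of `w` (`isNonneg_rep_root`). It implies
that an antidominant vector is the smallest in its orbit, so that heights stay positive and the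
normalised action is defined, and that two antidominant vectors in the same orbit coincide, with
the stabiliser generated by the simple reflections fixing the vector
(`eq_and_mem_parabolic_of_rep_eq`). With the description of the chamber map this gives that
`[w, k] ↦ w · F(k)` is well defined and injective.

For the topology, the stabiliser of `F(k)` is `W_T` for the smallest `T` supporting `k`, hence
finite, and a neighbourhood of `F(k)` in `V` is covered by the finitely many translates of the
antidominant chamber by `W_T` (`exists_isOpen_isAntidominant_rep`). So the preimage of a
neighbourhood of a point of the image is contained in a finite union of chambers, which is compact,
and a continuous injection with this property is an embedding
(`Topology.IsEmbedding.of_isCompact_preimage`).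
-/

/-! ### Alternating words -/

namespace CoxeterSystem

variable {B W : Type*} [Group W] {M : CoxeterMatrix B} (cs : CoxeterSystem M W)

/-- If `s` is not a right descent of `w`, then `w` factors, with additive lengths, as the minimal
representative `u` of the coset `w W_{s,t}` times an alternating word in `s` and `t`. -/
theorem exists_eq_mul_alternatingWord (w : W) (s t : B) (hs : ¬ cs.IsRightDescent w s) :
    ∃ (u : W) (n : ℕ), w = u * cs.wordProd (alternatingWord s t n) ∧
      cs.length w = cs.length u + n ∧ ¬ cs.IsRightDescent u s ∧ ¬ cs.IsRightDescent u t := by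
  induction hl : cs.length w generalizing w s t with
  | zero =>
    obtain rfl := cs.length_eq_zero_iff.1 hl
    exact ⟨1, 0, by simp [alternatingWord], by simp, hs, cs.not_isRightDescent_one t⟩
  | succ l ih =>
    by_cases ht : cs.IsRightDescent w t
    · have hl' := cs.isRightDescent_iff.1 ht
      obtain ⟨u, n, hu, hn, h1, h2⟩ := ih (w * cs.simple t) t s
        (cs.isRightDescent_iff_not_isRightDescent_mul.1 ht) (by omega)
      refine ⟨u, n + 1, ?_, by omega, h2, h1⟩
      rw [alternatingWord_succ, wordProd_concat, ← mul_assoc, ← hu,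
        simple_mul_simple_cancel_right]
    · exact ⟨w, 0, by simp [alternatingWord], by omega, hs, ht⟩

/-- In the situation of `exists_eq_mul_alternatingWord` the alternating word is shorter than the
order of `s t`: otherwise appending `s` would give a non-reduced alternating word. -/
theorem lt_of_eq_mul_alternatingWord {w u : W} {s t : B} {n : ℕ} (hs : ¬ cs.IsRightDescent w s)
    (hw : w = u * cs.wordProd (alternatingWord s t n)) (hn : cs.length w = cs.length u + n)
    (hM : M s t ≠ 0) : n < M s t := by
  by_contra! hlt
  have h1 := cs.not_isReduced_alternatingWord t s (m := n + 1) (by rwa [M.symmetric])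
    (by rw [M.symmetric]; omega)
  have h2 := cs.length_wordProd_le (alternatingWord t s (n + 1))
  rw [IsReduced] at h1
  rw [length_alternatingWord] at h1 h2
  have h3 := cs.not_isRightDescent_iff.1 hs
  rw [hw, mul_assoc, ← wordProd_concat, ← alternatingWord_succ, ← hw] at h3
  have h4 := cs.length_mul_le u (cs.wordProd (alternatingWord t s (n + 1)))
  omega

end CoxeterSystem

/-! ### Positivity of roots -/

namespace CoxeterDatum

/-- The coefficients of the roots of a dihedral parabolic subgroup: `dihedralCoeff c n` is the value
of the Chebyshev polynomial of the second kind of index `n - 1` at `c`. -/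
noncomputable def dihedralCoeff (c : ℝ) : ℕ → ℝ
  | 0 => 0
  | 1 => 1
  | n + 2 => 2 * c * dihedralCoeff c (n + 1) - dihedralCoeff c n

theorem dihedralCoeff_cos_mul_sin (θ : ℝ) (n : ℕ) :
    dihedralCoeff (Real.cos θ) n * Real.sin θ = Real.sin (n * θ) := by
  induction n using Nat.twoStepInduction with
  | zero => simp [dihedralCoeff]
  | one => simp [dihedralCoeff]
  | more n h0 h1 =>
    have e1 : ((n + 2 : ℕ) : ℝ) * θ = ((n + 1 : ℕ) : ℝ) * θ + θ := by push_cast; ring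
    have e0 : (n : ℝ) * θ = ((n + 1 : ℕ) : ℝ) * θ - θ := by push_cast; ring
    rw [dihedralCoeff, sub_mul, mul_assoc, h0, h1, e1, e0, Real.sin_add, Real.sin_sub]
    ring

theorem dihedralCoeff_nonneg_of_one_le {c : ℝ} (hc : 1 ≤ c) (n : ℕ) :
    0 ≤ dihedralCoeff c n := by
  have : 0 ≤ dihedralCoeff c n ∧ dihedralCoeff c n ≤ dihedralCoeff c (n + 1) := by
    induction n with
    | zero => simp [dihedralCoeff]
    | succ n ih =>
      refine ⟨ih.1.trans ih.2, ?_⟩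
      rw [dihedralCoeff]
      nlinarith [ih.1, ih.2]
  exact this.1

theorem dihedralCoeff_cos_pi_div_nonneg {m n : ℕ} (hm : 2 ≤ m) (hn : n ≤ m) :
    0 ≤ dihedralCoeff (Real.cos (Real.pi / m)) n := by
  have hm' : (2 : ℝ) ≤ m := by exact_mod_cast hm
  have hn' : (n : ℝ) ≤ m := by exact_mod_cast hn
  have hpi := Real.pi_pos
  have hsin : 0 < Real.sin (Real.pi / m) :=
    Real.sin_pos_of_pos_of_lt_pi (by positivity) (div_lt_self hpi (by linarith))
  refine nonneg_of_mul_nonneg_left ?_ hsin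
  rw [dihedralCoeff_cos_mul_sin]
  refine Real.sin_nonneg_of_nonneg_of_le_pi (by positivity) ?_
  rw [← mul_div_assoc, div_le_iff₀ (by linarith)]
  nlinarith

variable {B W V : Type*} [Group W] [AddCommGroup V] [Module ℝ V]
  {M : CoxeterMatrix B} (D : CoxeterDatum M V) (cs : CoxeterSystem M W)

theorem rep_alternatingWord_root (s t : B) (n : ℕ) :
    D.rep cs (cs.wordProd (CoxeterSystem.alternatingWord s t n)) (D.root s) =
      if Even n then
        dihedralCoeff (-D.form (D.root s) (D.root t)) (n + 1) • D.root s +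
          dihedralCoeff (-D.form (D.root s) (D.root t)) n • D.root t
      else
        dihedralCoeff (-D.form (D.root s) (D.root t)) n • D.root s +
          dihedralCoeff (-D.form (D.root s) (D.root t)) (n + 1) • D.root t := by
  have hsym := D.form_symm (D.root t) (D.root s)
  induction n with
  | zero => simp [CoxeterSystem.alternatingWord, dihedralCoeff]
  | succ n ih =>
    rw [CoxeterSystem.alternatingWord_succ', cs.wordProd_cons, map_mul, LinearEquiv.mul_apply, ih,
      rep_simple]
    by_cases hn : Even n
    · have hn' : ¬ Even (n + 1) := by simpa [Nat.even_add_one] using hn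
      simp only [hn, hn', if_true, if_false, reflection_apply, map_add, map_smul,
        form_root_self, hsym, dihedralCoeff]
      module
    · have hn' : Even (n + 1) := by simpa [Nat.even_add_one] using hn
      simp only [hn, hn', if_true, if_false, reflection_apply, map_add, map_smul,
        form_root_self, dihedralCoeff]
      module

/-- A vector is nonnegative if it lies in the cone spanned by the simple roots, that is, if its
coordinates in the basis of simple roots are nonnegative. -/
def IsNonneg (v : V) : Prop := ∀ s, 0 ≤ D.root.repr v s

variable {D} in
theorem IsNonneg.add {v v' : V} (h : D.IsNonneg v) (h' : D.IsNonneg v') :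
    D.IsNonneg (v + v') := fun s => by
  simpa using add_nonneg (h s) (h' s)

variable {D} in
theorem IsNonneg.smul {v : V} (h : D.IsNonneg v) {a : ℝ} (ha : 0 ≤ a) :
    D.IsNonneg (a • v) := fun s => by
  simpa using mul_nonneg ha (h s)

theorem isNonneg_root (s : B) : D.IsNonneg (D.root s) := fun t => by
  classical
  rw [D.root.repr_self, Finsupp.single_apply]
  split_ifs <;> simp

theorem two_le_of_ne {s t : B} (hst : s ≠ t) (h0 : M s t ≠ 0) : 2 ≤ M s t := by
  have := M.off_diagonal s t hst
  omega

theorem form_root_nonpos {s t : B} (hst : s ≠ t) : D.form (D.root s) (D.root t) ≤ 0 := by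
  by_cases h0 : M s t = 0
  · exact (D.form_root_of_eq_zero s t hst h0).trans (by norm_num)
  · rw [D.form_root_of_ne_zero s t hst h0, neg_nonpos]
    have h2 : (2 : ℝ) ≤ M s t := by exact_mod_cast two_le_of_ne hst h0
    have hpi := Real.pi_pos
    refine Real.cos_nonneg_of_mem_Icc ⟨by linarith [show 0 ≤ Real.pi / M s t by positivity], ?_⟩
    gcongr

/-- If `s` is not a right descent of `w`, then `w α_s` is a nonnegative combination of simple
roots. By induction on the length of `w`, this reduces to the minimal representative of the coset
`w W_{s,t}` (where `t` is a right descent of `w`) and a computation in the plane spanned by `α_s`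
and `α_t`. -/
theorem isNonneg_rep_root (w : W) (s : B) (hs : ¬ cs.IsRightDescent w s) :
    D.IsNonneg (D.rep cs w (D.root s)) := by
  induction hl : cs.length w using Nat.strong_induction_on generalizing w s with
  | _ l ih =>
    by_cases hw1 : w = 1
    · subst hw1
      simpa using D.isNonneg_root s
    obtain ⟨t, ht⟩ := cs.exists_rightDescent_of_ne_one hw1
    have hst : s ≠ t := fun h => hs (h ▸ ht)
    obtain ⟨u, n, hu, hn, hus, hut⟩ := cs.exists_eq_mul_alternatingWord w s t hs
    -- hence `u` is shorter than `w`, and the induction hypothesis applies to it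
    have hn0 : n ≠ 0 := by
      rintro rfl
      exact hut (by simpa [hu, CoxeterSystem.alternatingWord] using ht)
    have hs' := ih _ (by omega) u s hus rfl
    have ht' := ih _ (by omega) u t hut rfl
    have hcoeff : ∀ k ≤ n + 1, 0 ≤ dihedralCoeff (-D.form (D.root s) (D.root t)) k := by
      intro k hk
      by_cases h0 : M s t = 0
      · exact dihedralCoeff_nonneg_of_one_le (by linarith [D.form_root_of_eq_zero s t hst h0]) k
      · have := cs.lt_of_eq_mul_alternatingWord hs hu hn h0
        rw [D.form_root_of_ne_zero s t hst h0, neg_neg]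
        exact dihedralCoeff_cos_pi_div_nonneg (two_le_of_ne hst h0) (by omega)
    rw [hu, map_mul, LinearEquiv.mul_apply, rep_alternatingWord_root]
    split_ifs <;> rw [map_add, map_smul, map_smul]
    · exact (hs'.smul (hcoeff _ le_rfl)).add (ht'.smul (hcoeff _ (by omega)))
    · exact (hs'.smul (hcoeff _ (by omega))).add (ht'.smul (hcoeff _ le_rfl))

end CoxeterDatum

/-! ### The antidominant chamber and its stabilisers -/

namespace CoxeterDatum

variable {B W V : Type*} [Group W] [AddCommGroup V] [Module ℝ V]
  {M : CoxeterMatrix B} (D : CoxeterDatum M V) (cs : CoxeterSystem M W)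

/-- A vector is antidominant if its products with the simple roots are nonpositive. The cone `𝒦`
consists of the antidominant vectors in `PLC(Π)`. -/
def IsAntidominant (v : V) : Prop := ∀ s, D.form v (D.root s) ≤ 0

theorem form_rep_rep (w : W) (x y : V) :
    D.form (D.rep cs w x) (D.rep cs w y) = D.form x y := by
  induction w using cs.simple_induction_left with
  | one => simp
  | mul_simple_left w s ih =>
    rw [map_mul, LinearEquiv.mul_apply, LinearEquiv.mul_apply, rep_simple, reflection_apply,
      reflection_apply]
    simp only [map_sub, map_smul, LinearMap.sub_apply, LinearMap.smul_apply, smul_eq_mul,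
      form_root_self, ih, D.form_symm _ (D.root s)]
    ring

theorem rep_simple_eq_self_iff (s : B) (v : V) :
    D.rep cs (cs.simple s) v = v ↔ D.form v (D.root s) = 0 := by
  rw [rep_simple, reflection_apply, sub_eq_self, smul_eq_zero, D.form_symm]
  simp [D.root.ne_zero s]

theorem rep_eq_self_of_mem_parabolic {T : Set B} {v : V} (hv : ∀ s ∈ T, D.form v (D.root s) = 0)
    {w : W} (hw : w ∈ cs.parabolic T) : D.rep cs w v = v := by
  induction hw using Subgroup.closure_induction with
  | mem _ h =>
    obtain ⟨s, hs, rfl⟩ := h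
    exact (D.rep_simple_eq_self_iff cs s v).2 (hv s hs)
  | one => simp
  | mul x y _ _ hx hy => rw [map_mul, LinearEquiv.mul_apply, hy, hx]
  | inv x _ hx =>
    nth_rw 1 [← hx]
    rw [← LinearEquiv.mul_apply, ← map_mul, inv_mul_cancel, map_one, LinearEquiv.coe_one, id]

/-- An antidominant vector is the smallest in its orbit, for the order defined by the cone over the
simple roots. -/
theorem isNonneg_rep_sub {v : V} (hv : D.IsAntidominant v) (w : W) :
    D.IsNonneg (D.rep cs w v - v) := by
  induction hl : cs.length w generalizing w with
  | zero =>
    obtain rfl := cs.length_eq_zero_iff.1 hl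
    intro s
    simp
  | succ l ih =>
    obtain ⟨s, hs⟩ := cs.exists_rightDescent_of_ne_one (w := w) (by rintro rfl; simp at hl)
    have hl' := cs.isRightDescent_iff.1 hs
    have hpos := D.isNonneg_rep_root cs _ s (cs.isRightDescent_iff_not_isRightDescent_mul.1 hs)
    have e : D.rep cs w v - v = (D.rep cs (w * cs.simple s) v - v) +
        (-(2 * D.form v (D.root s))) • D.rep cs (w * cs.simple s) (D.root s) := by
      conv_lhs => rw [← cs.simple_mul_simple_cancel_right (w := w) s, map_mul,
        LinearEquiv.mul_apply, rep_simple, reflection_apply, D.form_symm]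
      rw [map_sub, map_smul]
      module
    rw [e]
    exact (ih _ (by omega)).add (hpos.smul (by linarith [hv s]))

/-- The antidominant chamber is a strict fundamental domain for its union of translates, and
stabilisers of antidominant vectors are standard parabolic subgroups. -/
theorem eq_and_mem_parabolic_of_rep_eq {x y : V} (hx : D.IsAntidominant x)
    (hy : D.IsAntidominant y) {w : W} (h : D.rep cs w x = y) :
    x = y ∧ w ∈ cs.parabolic {s | D.form x (D.root s) = 0} := by
  induction hl : cs.length w generalizing w with
  | zero =>
    obtain rfl := cs.length_eq_zero_iff.1 hl
    exact ⟨by simpa using h, one_mem _⟩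
  | succ l ih =>
    obtain ⟨s, hs⟩ := cs.exists_rightDescent_of_ne_one (w := w) (by rintro rfl; simp at hl)
    have hl' := cs.isRightDescent_iff.1 hs
    have hpos := D.isNonneg_rep_root cs _ s (cs.isRightDescent_iff_not_isRightDescent_mul.1 hs)
    set w' := w * cs.simple s with hw'
    have hw : w = w' * cs.simple s := (cs.simple_mul_simple_cancel_right s).symm
    have hroot : D.rep cs w (D.root s) = -D.rep cs w' (D.root s) := by
      rw [hw, map_mul, LinearEquiv.mul_apply, rep_simple, reflection_apply, form_root_self,
        ← map_neg]
      congr 1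
      module
    -- `(x, α_s) = (y, w α_s)` is nonnegative, as `w α_s` is a combination of simple roots with
    -- nonpositive coefficients
    have h0 : D.form x (D.root s) = 0 := by
      refine le_antisymm (hx s) ?_
      rw [← D.form_rep_rep cs w, h, hroot, map_neg, Left.nonneg_neg_iff,
        ← D.root.linearCombination_repr (D.rep cs w' (D.root s)), Finsupp.linearCombination_apply,
        Finsupp.sum, map_sum]
      refine Finset.sum_nonpos fun t _ => ?_
      rw [map_smul, smul_eq_mul]
      exact mul_nonpos_of_nonneg_of_nonpos (hpos t) (hy t)
    have hsx := (D.rep_simple_eq_self_iff cs s x).2 h0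
    obtain ⟨hxy, hmem⟩ := ih (w := w') (by rw [hw', map_mul, LinearEquiv.mul_apply, hsx, h])
      (by omega)
    refine ⟨hxy, ?_⟩
    rw [hw]
    exact mul_mem hmem (Subgroup.subset_closure ⟨s, h0, rfl⟩)

section Finite

variable [Fintype B]

theorem height_apply (v : V) : D.height v = ∑ s, D.root.repr v s := by
  simp [height, LinearMap.sum_apply]

@[simp]
theorem height_root (s : B) : D.height (D.root s) = 1 := by
  classical
  simp [height_apply, Finsupp.single_apply]

variable {D} in
theorem IsNonneg.height_nonneg {v : V} (hv : D.IsNonneg v) : 0 ≤ D.height v := by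
  rw [height_apply]
  exact Finset.sum_nonneg fun s _ => hv s

theorem height_le_height_rep {v : V} (hv : D.IsAntidominant v) (w : W) :
    D.height v ≤ D.height (D.rep cs w v) := by
  have := (D.isNonneg_rep_sub cs hv w).height_nonneg
  rwa [map_sub, sub_nonneg] at this

theorem mem_plc_iff {v : V} : v ∈ D.plc ↔ D.IsNonneg v ∧ 0 < D.height v := by
  constructor
  · rintro ⟨c, hc, ⟨s, hs⟩, rfl⟩
    refine ⟨fun t => by rw [D.root.repr_sum_self]; exact hc t, ?_⟩
    simpa using Finset.sum_pos' (fun t _ => hc t) ⟨s, Finset.mem_univ s, hs⟩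
  · rintro ⟨h, hpos⟩
    refine ⟨fun s => D.root.repr v s, h, ?_, (D.root.sum_repr v).symm⟩
    by_contra! hle
    rw [height_apply] at hpos
    exact hpos.not_ge (Finset.sum_nonpos fun s _ => hle s)

theorem mem_coneK_iff {v : V} :
    v ∈ D.coneK ↔ (D.IsNonneg v ∧ 0 < D.height v) ∧ D.IsAntidominant v := by
  rw [← mem_plc_iff]
  rfl

theorem dot_dot {w w' : W} {v : V} (h : D.height (D.rep cs w' v) ≠ 0) :
    D.dot cs w (D.dot cs w' v) = D.dot cs (w * w') v := by
  simp only [dot, normalize, map_smul, map_mul, LinearEquiv.mul_apply, smul_smul, smul_eq_mul]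
  congr 1
  field_simp

/-- If `g` carries the point `w · x` of the orbit of an antidominant vector `x` back into the
antidominant chamber, then `g w` lies in the stabiliser of `x`. -/
theorem mem_parabolic_of_isAntidominant_rep_dot {x : V} (hx : D.IsAntidominant x)
    (hpos : 0 < D.height x) {g w : W} (h : D.IsAntidominant (D.rep cs g (D.dot cs w x))) :
    g * w ∈ cs.parabolic {s | D.form x (D.root s) = 0} := by
  have hh : 0 < D.height (D.rep cs w x) := hpos.trans_le (D.height_le_height_rep cs hx w)
  refine (D.eq_and_mem_parabolic_of_rep_eq cs hx (y := D.rep cs (g * w) x) (fun s => ?_) rfl).2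
  have hs := h s
  rw [dot, normalize, map_smul, map_smul, LinearMap.smul_apply, smul_eq_mul,
    ← LinearEquiv.mul_apply, ← map_mul] at hs
  exact nonpos_of_mul_nonpos_right hs (inv_pos.2 hh)

/-- An element of a finite parabolic subgroup `W_T` moves any vector to a vector whose products with
the simple roots in `T` are nonpositive: take an element of minimal height in the orbit. -/
theorem exists_mem_parabolic_forall_form_nonpos (T : Set B) [Finite (cs.parabolic T)] (y : V) :
    ∃ g ∈ cs.parabolic T, ∀ t ∈ T, D.form (D.rep cs g y) (D.root t) ≤ 0 := by
  obtain ⟨g, hg⟩ := Finite.exists_min fun g : cs.parabolic T => D.height (D.rep cs (g : W) y)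
  refine ⟨g, g.2, fun t ht => ?_⟩
  have := hg (⟨cs.simple t, Subgroup.subset_closure ⟨t, ht, rfl⟩⟩ * g)
  simp only [Subgroup.coe_mul, map_mul, LinearEquiv.mul_apply, rep_simple, reflection_apply,
    map_sub, map_smul, height_root, smul_eq_mul] at this
  rw [D.form_symm]
  linarith

/-- Points near an antidominant vector `x` with finite stabiliser lie in the translates of the
antidominant chamber by this stabiliser. -/
theorem exists_isOpen_isAntidominant_rep [TopologicalSpace V] [IsTopologicalAddGroup V]
    [ContinuousSMul ℝ V] [T2Space V] {x : V} (hx : D.IsAntidominant x)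
    (hfin : Finite (cs.parabolic {s | D.form x (D.root s) = 0})) :
    ∃ N : Set V, IsOpen N ∧ x ∈ N ∧ ∀ y ∈ N,
      ∃ g ∈ cs.parabolic {s | D.form x (D.root s) = 0}, D.IsAntidominant (D.rep cs g y) := by
  have : FiniteDimensional ℝ V := Module.Finite.of_basis D.root
  set T : Set B := {s | D.form x (D.root s) = 0} with hT
  refine ⟨⋂ g : cs.parabolic T, ⋂ s ∈ Tᶜ, {y | D.form.flip (D.root s) (D.rep cs (g : W) y) < 0},
    ?_, ?_, ?_⟩
  · refine isOpen_iInter_of_finite fun g => Set.Finite.isOpen_biInter (Set.toFinite _) fun s _ => ?_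
    exact isOpen_lt ((D.form.flip (D.root s) ∘ₗ
      (D.rep cs (g : W)).toLinearMap).continuous_of_finiteDimensional) continuous_const
  · simp only [mem_iInter]
    intro g s hs
    have e := D.rep_eq_self_of_mem_parabolic cs (T := T) (v := x) (fun t ht => ht) g.2
    simpa [e] using lt_of_le_of_ne (hx s) hs
  · intro y hy
    simp only [mem_iInter] at hy
    obtain ⟨g, hg, hgT⟩ := D.exists_mem_parabolic_forall_form_nonpos cs T y
    refine ⟨g, hg, fun s => ?_⟩
    by_cases hs : s ∈ T
    · exact hgT s hs
    · exact (hy ⟨g, hg⟩ s hs).le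

end Finite

end CoxeterDatum

/-! ### The vertices `v_T` and the map on the Davis chamber -/

namespace CoxeterDatum

variable {B W V : Type*} [Group W] [AddCommGroup V] [Module ℝ V]
  {M : CoxeterMatrix B} (D : CoxeterDatum M V) (cs : CoxeterSystem M W)

/-- The parabolic subgroup `W_T` changes only the coordinates in `T`. -/
theorem repr_rep_of_notMem {T : Set B} {w : W} (hw : w ∈ cs.parabolic T) {s : B} (hs : s ∉ T)
    (v : V) : D.root.repr (D.rep cs w v) s = D.root.repr v s := by
  classical
  induction hw using Subgroup.closure_induction generalizing v with
  | mem _ h =>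
    obtain ⟨t, ht, rfl⟩ := h
    have hts : t ≠ s := fun h => hs (h ▸ ht)
    simp [rep_simple, reflection_apply, hts]
  | one => simp
  | mul x y _ _ hx hy => rw [map_mul, LinearEquiv.mul_apply, hx, hy]
  | inv x _ hx =>
    rw [← hx, ← LinearEquiv.mul_apply, ← map_mul, mul_inv_cancel, map_one, LinearEquiv.coe_one, id]

/-- The average `c_T` of the `W_T`-orbit of `v₀`, whose normalisation is `v_T`. -/
noncomputable def orbitAverage (v₀ : V) (T : cs.Spherical) : V :=
  (Nat.card (cs.parabolic T.1) : ℝ)⁻¹ • ∑ᶠ g : cs.parabolic T.1, D.rep cs (g : W) v₀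

theorem vertexImage_eq [Fintype B] (v₀ : V) (T : cs.Spherical) :
    D.vertexImage cs v₀ T = (D.height (D.orbitAverage cs v₀ T))⁻¹ • D.orbitAverage cs v₀ T := rfl

theorem rep_orbitAverage (v₀ : V) (T : cs.Spherical) {w : W} (hw : w ∈ cs.parabolic T.1) :
    D.rep cs w (D.orbitAverage cs v₀ T) = D.orbitAverage cs v₀ T := by
  let := Fintype.ofFinite (cs.parabolic T.1)
  rw [orbitAverage, map_smul, finsum_eq_sum_of_fintype, map_sum]
  congr 1
  refine Fintype.sum_equiv (Equiv.mulLeft ⟨w, hw⟩) _ _ fun g => ?_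
  simp

theorem repr_orbitAverage_of_notMem (v₀ : V) (T : cs.Spherical) {s : B} (hs : s ∉ T.1) :
    D.root.repr (D.orbitAverage cs v₀ T) s = D.root.repr v₀ s := by
  let := Fintype.ofFinite (cs.parabolic T.1)
  have hc : (Nat.card (cs.parabolic T.1) : ℝ) ≠ 0 := by exact_mod_cast Nat.card_pos.ne'
  rw [orbitAverage, finsum_eq_sum_of_fintype]
  simp only [map_smul, map_sum, Finsupp.smul_apply, Finsupp.finsetSum_apply, smul_eq_mul,
    D.repr_rep_of_notMem cs (Subtype.prop _) hs, Finset.sum_const, Finset.card_univ, nsmul_eq_mul,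
    ← Nat.card_eq_fintype_card]
  field_simp

theorem repr_le_repr_orbitAverage {v₀ : V} (hv₀ : D.IsAntidominant v₀) (T : cs.Spherical) (s : B) :
    D.root.repr v₀ s ≤ D.root.repr (D.orbitAverage cs v₀ T) s := by
  let := Fintype.ofFinite (cs.parabolic T.1)
  have hc : (0 : ℝ) < Nat.card (cs.parabolic T.1) := by exact_mod_cast Nat.card_pos
  rw [orbitAverage, finsum_eq_sum_of_fintype]
  simp only [map_smul, map_sum, Finsupp.smul_apply, Finsupp.finsetSum_apply, smul_eq_mul]
  rw [inv_mul_eq_div, le_div_iff₀ hc, mul_comm, ← nsmul_eq_mul, Nat.card_eq_fintype_card,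
    ← Finset.card_univ]
  refine Finset.card_nsmul_le_sum _ _ _ fun g _ => ?_
  simpa using D.isNonneg_rep_sub cs hv₀ (g : W) s

theorem form_orbitAverage_of_mem (v₀ : V) (T : cs.Spherical) {s : B} (hs : s ∈ T.1) :
    D.form (D.orbitAverage cs v₀ T) (D.root s) = 0 :=
  (D.rep_simple_eq_self_iff cs s _).1
    (D.rep_orbitAverage cs v₀ T (Subgroup.subset_closure ⟨s, hs, rfl⟩))

/-- As `c_T - v₀` is a nonnegative combination of the simple roots in `T`, its products with the
remaining simple roots are nonpositive. -/
theorem form_orbitAverage_of_notMem [Fintype B] {v₀ : V} (hv₀ : ∀ s, D.form v₀ (D.root s) < 0)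
    (T : cs.Spherical) {s : B} (hs : s ∉ T.1) :
    D.form (D.orbitAverage cs v₀ T) (D.root s) < 0 := by
  set c := D.orbitAverage cs v₀ T with hc
  have hle : D.form (c - v₀) (D.root s) ≤ 0 := by
    rw [← D.root.sum_repr (c - v₀), map_sum, LinearMap.sum_apply]
    refine Finset.sum_nonpos fun t _ => ?_
    rw [map_smul, LinearMap.smul_apply, smul_eq_mul, map_sub, Finsupp.sub_apply]
    by_cases ht : t ∈ T.1
    · exact mul_nonpos_of_nonneg_of_nonpos
        (sub_nonneg.2 (D.repr_le_repr_orbitAverage cs (fun s => (hv₀ s).le) T t))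
        (D.form_root_nonpos fun h => hs (h ▸ ht))
    · rw [hc, D.repr_orbitAverage_of_notMem cs v₀ T ht, sub_self, zero_mul]
  rw [map_sub, LinearMap.sub_apply] at hle
  linarith [hv₀ s]

section Finite

variable [Fintype B]

section VertexImage

variable {D} {v₀ : V} (hK : v₀ ∈ D.coneK) (hneg : ∀ s, D.form v₀ (D.root s) < 0)

include hK

theorem height_orbitAverage_pos (T : cs.Spherical) : 0 < D.height (D.orbitAverage cs v₀ T) := by
  obtain ⟨⟨-, h⟩, ha⟩ := D.mem_coneK_iff.1 hK
  refine h.trans_le ?_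
  rw [height_apply, height_apply]
  exact Finset.sum_le_sum fun s _ => D.repr_le_repr_orbitAverage cs ha T s

theorem height_vertexImage (T : cs.Spherical) : D.height (D.vertexImage cs v₀ T) = 1 := by
  have := (height_orbitAverage_pos cs hK T).ne'
  simp [vertexImage_eq, this]

theorem isNonneg_vertexImage (T : cs.Spherical) : D.IsNonneg (D.vertexImage cs v₀ T) := by
  obtain ⟨⟨hn, -⟩, ha⟩ := D.mem_coneK_iff.1 hK
  rw [vertexImage_eq]
  refine IsNonneg.smul (fun s => ?_) (inv_nonneg.2 (height_orbitAverage_pos cs hK T).le)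
  exact (hn s).trans (D.repr_le_repr_orbitAverage cs ha T s)

include hneg

theorem form_vertexImage_nonpos (T : cs.Spherical) (s : B) :
    D.form (D.vertexImage cs v₀ T) (D.root s) ≤ 0 := by
  rw [vertexImage_eq, map_smul, LinearMap.smul_apply, smul_eq_mul]
  refine mul_nonpos_of_nonneg_of_nonpos (inv_nonneg.2 (height_orbitAverage_pos cs hK T).le) ?_
  by_cases hs : s ∈ T.1
  · exact (D.form_orbitAverage_of_mem cs v₀ T hs).le
  · exact (D.form_orbitAverage_of_notMem cs hneg T hs).le

theorem form_vertexImage_eq_zero_iff (T : cs.Spherical) (s : B) :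
    D.form (D.vertexImage cs v₀ T) (D.root s) = 0 ↔ s ∈ T.1 := by
  rw [vertexImage_eq, map_smul, LinearMap.smul_apply, smul_eq_zero,
    or_iff_right (inv_ne_zero (height_orbitAverage_pos cs hK T).ne')]
  exact ⟨fun h => by_contra fun hs => (D.form_orbitAverage_of_notMem cs hneg T hs).ne h,
    D.form_orbitAverage_of_mem cs v₀ T⟩

theorem form_sum_vertexImage_eq_zero_iff {p : cs.Spherical → ℝ} (hp : ∀ T, 0 ≤ p T) (s : B) :
    D.form (∑ T, p T • D.vertexImage cs v₀ T) (D.root s) = 0 ↔ ∀ T, p T ≠ 0 → s ∈ T.1 := by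
  simp only [map_sum, map_smul, LinearMap.sum_apply, LinearMap.smul_apply, smul_eq_mul]
  rw [Finset.sum_eq_zero_iff_of_nonpos fun T _ =>
    mul_nonpos_of_nonneg_of_nonpos (hp T) (form_vertexImage_nonpos cs hK hneg T s)]
  simp only [Finset.mem_univ, true_imp_iff, mul_eq_zero,
    form_vertexImage_eq_zero_iff cs hK hneg, or_iff_not_imp_left]

/-- Nonnegative combinations of the `v_T` with support in a chain determine their coefficients. The
smallest element `T` of the support is the set of simple roots orthogonal to the combination; the
smaller of the two coefficients of `v_T` is subtracted from both combinations, which makes one of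
the supports smaller. -/
theorem eq_of_sum_smul_vertexImage_eq {p q : cs.Spherical → ℝ} (hp : ∀ T, 0 ≤ p T)
    (hq : ∀ T, 0 ≤ q T) (hcp : IsChain (· ≤ ·) (Function.support p))
    (hcq : IsChain (· ≤ ·) (Function.support q))
    (h : ∑ T, p T • D.vertexImage cs v₀ T = ∑ T, q T • D.vertexImage cs v₀ T) : p = q := by
  classical
  induction hn : (Function.support p).ncard + (Function.support q).ncard using
    Nat.strong_induction_on generalizing p q with
  | _ n ih =>
    have hsum : ∑ T, p T = ∑ T, q T := by
      simpa [height_vertexImage cs hK] using congrArg D.height h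
    have hzero : ∀ r : cs.Spherical → ℝ, (∀ T, 0 ≤ r T) → ∑ T, r T = 0 → r = 0 := fun r hr h0 =>
      funext fun T => (Finset.sum_eq_zero_iff_of_nonneg fun T _ => hr T).1 h0 T (Finset.mem_univ T)
    by_cases hp0 : p = 0
    · rw [hp0, hzero q hq (by rw [← hsum]; simp [hp0])]
    by_cases hq0 : q = 0
    · rw [hq0, hzero p hp (by rw [hsum]; simp [hq0])]
    have hmin : ∀ r : cs.Spherical → ℝ, r ≠ 0 → IsChain (· ≤ ·) (Function.support r) →
        ∃ T, r T ≠ 0 ∧ ∀ T', r T' ≠ 0 → T ≤ T' := by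
      intro r hr hc
      obtain ⟨T, hT⟩ := (Set.toFinite (Function.support r)).exists_minimal
        (Function.support_nonempty_iff.2 hr)
      refine ⟨T, hT.1, fun T' hT' => ?_⟩
      rcases hc.total hT.1 hT' with h | h
      · exact h
      · exact hT.2 hT' h
    obtain ⟨T, hT, hTmin⟩ := hmin p hp0 hcp
    obtain ⟨T', hT', hTmin'⟩ := hmin q hq0 hcq
    obtain rfl : T = T' := by
      have hz := fun s => (form_sum_vertexImage_eq_zero_iff cs hK hneg hp s).symm.trans
        (h ▸ form_sum_vertexImage_eq_zero_iff cs hK hneg hq s)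
      refine Subtype.ext (Set.ext fun s => ⟨fun hs => ?_, fun hs => ?_⟩)
      · exact (hz s).1 (fun R hR => hTmin R hR hs) T' hT'
      · exact (hz s).2 (fun R hR => hTmin' R hR hs) T hT
    clear hsum hzero hp0 hq0 hmin
    wlog hle : p T ≤ q T generalizing p q
    · exact (this hq hp hcq hcp h.symm (by omega) hT' hTmin' hT hTmin (le_of_not_ge hle)).symm
    have hsub : ∀ r : cs.Spherical → ℝ, r T ≠ 0 →
        Function.support (r - Pi.single T (p T)) ⊆ Function.support r := by
      intro r hr R hR hR'
      have hne : R ≠ T := by rintro rfl; exact hr hR'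
      exact hR (by simp [hne, hR'])
    have key : p - Pi.single T (p T) = q - Pi.single T (p T) := by
      refine ih _ ?_ ?_ ?_ (hcp.mono (hsub p hT)) (hcq.mono (hsub q hT')) ?_ rfl
      · have h1 : (Function.support (p - Pi.single T (p T))).ncard < (Function.support p).ncard :=
          Set.ncard_lt_ncard ((hsub p hT).ssubset_of_mem_notMem (a := T) hT (by simp))
        have h2 := Set.ncard_le_ncard (hsub q hT')
        omega
      · intro R
        by_cases hR : R = T
        · subst hR; simp
        · simpa [hR] using hp R
      · intro R
        by_cases hR : R = T
        · subst hR; simpa using hle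
        · simpa [hR] using hq R
      · simp only [Pi.sub_apply, sub_smul, Finset.sum_sub_distrib, h]
    simpa using key

end VertexImage

section ChamberMap

variable {D cs} {v₀ : V} (hK : v₀ ∈ D.coneK) (hneg : ∀ s, D.form v₀ (D.root s) < 0)

include hK

theorem height_chamberMap (k : cs.Chamber) : D.height (D.chamberMap cs v₀ k) = 1 := by
  simp [chamberMap, height_vertexImage cs hK, k.2.1.2]

theorem isNonneg_chamberMap (k : cs.Chamber) : D.IsNonneg (D.chamberMap cs v₀ k) := fun s => by
  simp only [chamberMap, map_sum, map_smul, Finsupp.finsetSum_apply, Finsupp.smul_apply]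
  exact Finset.sum_nonneg fun T _ => mul_nonneg (k.2.1.1 T) (isNonneg_vertexImage cs hK T s)

include hneg

theorem isAntidominant_chamberMap (k : cs.Chamber) :
    D.IsAntidominant (D.chamberMap cs v₀ k) := fun s => by
  simp only [chamberMap, map_sum, map_smul, LinearMap.sum_apply, LinearMap.smul_apply]
  exact Finset.sum_nonpos fun T _ =>
    mul_nonpos_of_nonneg_of_nonpos (k.2.1.1 T) (form_vertexImage_nonpos cs hK hneg T s)

theorem chamberMap_mem_coneK (k : cs.Chamber) : D.chamberMap cs v₀ k ∈ D.coneK :=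
  D.mem_coneK_iff.2 ⟨⟨isNonneg_chamberMap hK k, by simp [height_chamberMap hK]⟩,
    isAntidominant_chamberMap hK hneg k⟩

theorem chamberMap_injective : Function.Injective (D.chamberMap cs v₀) := fun k k' h =>
  Subtype.ext (eq_of_sum_smul_vertexImage_eq cs hK hneg k.2.1.1 k'.2.1.1 k.2.2 k'.2.2 h)

theorem form_chamberMap_eq_zero_iff (k : cs.Chamber) (s : B) :
    D.form (D.chamberMap cs v₀ k) (D.root s) = 0 ↔ ∀ T, k.1 T ≠ 0 → s ∈ T.1 :=
  form_sum_vertexImage_eq_zero_iff cs hK hneg k.2.1.1 s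

end ChamberMap

end Finite

end CoxeterDatum

namespace CoxeterSystem

variable {B W : Type*} [Group W] {M : CoxeterMatrix B} {cs : CoxeterSystem M W}

theorem parabolic_mono {T T' : Set B} (h : T ⊆ T') : cs.parabolic T ≤ cs.parabolic T' :=
  Subgroup.closure_mono (Set.image_mono h)

theorem exists_coeff_ne_zero [Finite B] (k : cs.Chamber) : ∃ T, k.1 T ≠ 0 := by
  by_contra! h
  simpa [h] using k.2.1.2

/-- A point lies in the mirror `K_s` iff `s` belongs to all members of its supporting chain, because
`{s}` may then be added to this chain. -/
theorem mem_mirror_iff [Finite B] {k : cs.Chamber} {s : B} :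
    k ∈ mirror s ↔ ∀ T, k.1 T ≠ 0 → s ∈ T.1 := by
  constructor
  · rintro ⟨c, -, ⟨T, -, hTs, hmin⟩, hsupp⟩ T' hT'
    exact hmin T' (hsupp hT') (by simp [hTs])
  · intro h
    obtain ⟨R, hR⟩ := exists_coeff_ne_zero k
    let T : cs.Spherical := ⟨{s}, Finite.of_injective _
      (Subgroup.inclusion_injective (parabolic_mono (Set.singleton_subset_iff.2 (h R hR))))⟩
    have hT : ∀ T' ∈ Function.support k.1, T ≤ T' :=
      fun T' hT' => Set.singleton_subset_iff.2 (h T' hT')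
    refine ⟨insert T (Function.support k.1), k.2.2.insert fun T' hT' _ => Or.inl (hT T' hT'),
      ⟨T, Set.mem_insert _ _, rfl, ?_⟩, Set.subset_insert _ _⟩
    rintro T' (rfl | hT')
    exacts [le_rfl, hT T' hT']

theorem finite_isotropy [Finite B] (k : cs.Chamber) : Finite (cs.isotropy k) := by
  obtain ⟨R, hR⟩ := exists_coeff_ne_zero k
  exact Finite.of_injective _ (Subgroup.inclusion_injective
    (parabolic_mono (T' := R.1) fun s hs => mem_mirror_iff.1 hs R hR))

end CoxeterSystem

theorem CoxeterDatum.parabolic_form_chamberMap_eq_isotropy {B W V : Type*} [Fintype B] [Group W]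
    [AddCommGroup V] [Module ℝ V] {M : CoxeterMatrix B} {cs : CoxeterSystem M W}
    {D : CoxeterDatum M V} {v₀ : V} (hK : v₀ ∈ D.coneK) (hneg : ∀ s, D.form v₀ (D.root s) < 0)
    (k : cs.Chamber) :
    cs.parabolic {s | D.form (D.chamberMap cs v₀ k) (D.root s) = 0} = cs.isotropy k := by
  simp only [CoxeterSystem.isotropy, form_chamberMap_eq_zero_iff hK hneg,
    CoxeterSystem.mem_mirror_iff]

/-! ### Topology of the Davis complex -/

/-- A continuous injection into a Hausdorff space is an embedding if every point of its image has a
neighbourhood whose preimage is contained in a compact set. -/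
theorem Topology.IsEmbedding.of_isCompact_preimage {X Y : Type*} [TopologicalSpace X]
    [TopologicalSpace Y] [T2Space Y] {f : X → Y} (hf : Continuous f)
    (hinj : Function.Injective f)
    (h : ∀ x, ∃ N ∈ 𝓝 (f x), ∃ Q, IsCompact Q ∧ f ⁻¹' N ⊆ Q) : IsEmbedding f := by
  refine ⟨isInducing_iff_nhds.2 fun x => le_antisymm (hf.tendsto x).le_comap ?_, hinj⟩
  intro U hU
  obtain ⟨O, hOU, hO, hxO⟩ := mem_nhds_iff.1 hU
  obtain ⟨N, hN, Q, hQ, hNQ⟩ := h x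
  have hclosed : IsClosed (f '' (Q \ O)) := ((hQ.diff hO).image hf).isClosed
  have hx : f x ∉ f '' (Q \ O) := by
    rintro ⟨y, hy, hyx⟩
    exact hy.2 (hinj hyx ▸ hxO)
  refine Filter.mem_comap.2 ⟨N ∩ (f '' (Q \ O))ᶜ,
    Filter.inter_mem hN (hclosed.isOpen_compl.mem_nhds hx), fun y hy => hOU ?_⟩
  by_contra hyO
  exact hy.2 ⟨y, ⟨hNQ hy.1, hyO⟩, rfl⟩

namespace CoxeterSystem

variable {B W : Type*} [Group W] {M : CoxeterMatrix B} (cs : CoxeterSystem M W)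

instance [Finite B] : CompactSpace cs.Chamber := by
  refine isCompact_iff_compactSpace.1 ((isCompact_stdSimplex ℝ cs.Spherical).inter_right
    (t := {k | IsChain (· ≤ ·) (Function.support k)}) ?_)
  -- a support is a chain iff one of any two incomparable coordinates vanishes
  have e : {k : cs.Spherical → ℝ | IsChain (· ≤ ·) (Function.support k)} =
      ⋂ (T : cs.Spherical) (T' : cs.Spherical) (_ : T ≠ T' ∧ ¬ (T ≤ T' ∨ T' ≤ T)),
        {k | k T * k T' = 0} := by
    ext k
    simp only [mem_ofPred_eq, mem_iInter, mul_eq_zero]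
    constructor
    · intro h T T' hT
      by_contra! h0
      exact hT.2 (h h0.1 h0.2 hT.1)
    · intro h T hT T' hT' hne
      by_contra h0
      exact (h T T' ⟨hne, h0⟩).elim hT hT'
  rw [e]
  refine isClosed_iInter fun T => isClosed_iInter fun T' => isClosed_iInter fun _ => ?_
  exact isClosed_eq ((continuous_apply T).mul (continuous_apply T')) continuous_const

variable [Finite B]

theorem continuous_davisMk (w : W) : Continuous (cs.davisMk w) :=
  letI : TopologicalSpace W := ⊥
  continuous_quotient_mk'.comp (Continuous.prodMk_right w)

theorem davisMk_surjective (x : cs.Davis) : ∃ w k, cs.davisMk w k = x := by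
  obtain ⟨p, rfl⟩ := Quotient.exists_rep x
  exact ⟨p.1, p.2, rfl⟩

theorem davisMk_eq_iff {w w' : W} {k k' : cs.Chamber} :
    cs.davisMk w k = cs.davisMk w' k' ↔ k = k' ∧ w⁻¹ * w' ∈ cs.isotropy k :=
  Quotient.eq

theorem continuous_davis_iff {Y : Type*} [TopologicalSpace Y] {f : cs.Davis → Y} :
    Continuous f ↔ ∀ w, Continuous fun k => f (cs.davisMk w k) := by
  refine ⟨fun h w => h.comp (cs.continuous_davisMk w), fun h => ?_⟩
  let : TopologicalSpace W := ⊥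
  have : DiscreteTopology W := ⟨rfl⟩
  exact isQuotientMap_quotient_mk'.continuous_iff.2 (continuous_prod_of_discrete_left.2 h)

end CoxeterSystem

/-! ### The embedding of the Davis complex -/

namespace CoxeterDatum

variable {B W V : Type*} [Fintype B] [Group W] [AddCommGroup V] [Module ℝ V]
  {M : CoxeterMatrix B} (D : CoxeterDatum M V) (cs : CoxeterSystem M W)

theorem chamberK_subset_coneK : D.chamberK ⊆ D.coneK := by
  rintro _ ⟨v, ⟨hv, -⟩, rfl⟩
  obtain ⟨⟨hn, hh⟩, ha⟩ := D.mem_coneK_iff.1 hv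
  have hi : 0 < (D.height v)⁻¹ := inv_pos.2 hh
  refine D.mem_coneK_iff.2 ⟨⟨hn.smul hi.le, ?_⟩, fun s => ?_⟩
  · rw [normalize, map_smul, smul_eq_mul]
    positivity
  · rw [normalize, map_smul, LinearMap.smul_apply]
    exact mul_nonpos_of_nonneg_of_nonpos hi.le (ha s)

theorem mem_coneK_of_mem_interiorK [TopologicalSpace V] {v₀ : V} (h : v₀ ∈ D.interiorK) :
    v₀ ∈ D.coneK := by
  obtain ⟨v, hv, rfl⟩ := h
  exact D.chamberK_subset_coneK
    (interior_subset (s := {x : D.V₁ | (x : V) ∈ D.chamberK}) hv)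

/-- At an interior point `v₀` of `𝒦̂` the inequalities defining `𝒦` are strict: if `(v₀, α_s) = 0`,
then moving from `v₀` a little towards `α_s ∈ V₁` leaves `𝒦̂`. -/
theorem form_neg_of_mem_interiorK [TopologicalSpace V] [IsTopologicalAddGroup V]
    [ContinuousSMul ℝ V] {v₀ : V} (h : v₀ ∈ D.interiorK) (s : B) :
    D.form v₀ (D.root s) < 0 := by
  have hK := (D.mem_coneK_iff.1 (D.mem_coneK_of_mem_interiorK h)).2
  obtain ⟨v, hv, rfl⟩ := h
  refine lt_of_le_of_ne (hK s) fun h0 => ?_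
  have hh : D.height v = 1 := v.2
  let γ : ℝ → D.V₁ := fun ε => ⟨(v : V) + ε • (D.root s - v), by simp [V₁, hh]⟩
  have hγ : Continuous γ := by fun_prop
  have hγ0 : γ 0 = v := Subtype.ext (by simp [γ])
  have hev : ∀ᶠ ε in 𝓝 (0 : ℝ), γ ε ∈ interior {x : D.V₁ | (x : V) ∈ D.chamberK} :=
    hγ.continuousAt.eventually_mem (isOpen_interior.mem_nhds (by rwa [hγ0]))
  obtain ⟨ε, hε, hε0⟩ := ((hev.filter_mono nhdsWithin_le_nhds).and
    (self_mem_nhdsWithin : Ioi (0 : ℝ) ∈ 𝓝[>] 0)).exists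
  have hle := (D.mem_coneK_iff.1 (D.mem_coneK_of_mem_interiorK ⟨_, hε, rfl⟩)).2 s
  have : D.form (γ ε) (D.root s) = ε := by
    simp [γ, h0, form_root_self]
  rw [this] at hle
  exact not_lt_of_ge hle hε0

variable {D} {v₀ : V} (hK : v₀ ∈ D.coneK) (hneg : ∀ s, D.form v₀ (D.root s) < 0)

include hK hneg

theorem height_rep_chamberMap_pos (w : W) (k : cs.Chamber) :
    0 < D.height (D.rep cs w (D.chamberMap cs v₀ k)) := by
  have h := D.height_le_height_rep cs (isAntidominant_chamberMap hK hneg k) w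
  rw [height_chamberMap hK] at h
  linarith

/-- The map `[w, k] ↦ w · F(k)` on the Davis complex, with values in `V`. -/
noncomputable def davisMap : cs.Davis → V :=
  Quotient.lift (fun p : W × cs.Chamber => D.dot cs p.1 (D.chamberMap cs v₀ p.2)) (by
    rintro ⟨w, k⟩ ⟨w', k'⟩ ⟨rfl, h⟩
    dsimp only at h ⊢
    rw [← parabolic_form_chamberMap_eq_isotropy hK hneg] at h
    have := D.rep_eq_self_of_mem_parabolic cs (fun s hs => hs) h
    rw [dot, dot, ← mul_inv_cancel_left w w', map_mul, LinearEquiv.mul_apply, this])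

theorem davisMap_davisMk (w : W) (k : cs.Chamber) :
    davisMap cs hK hneg (cs.davisMk w k) = D.dot cs w (D.chamberMap cs v₀ k) := rfl

theorem davisMap_smul (w : W) (x : cs.Davis) :
    davisMap cs hK hneg (w • x) = D.dot cs w (davisMap cs hK hneg x) := by
  obtain ⟨w', k, rfl⟩ := cs.davisMk_surjective x
  rw [CoxeterSystem.smul_davisMk, davisMap_davisMk, davisMap_davisMk,
    D.dot_dot cs (height_rep_chamberMap_pos cs hK hneg w' k).ne']

theorem davisMap_mem_Z (x : cs.Davis) : davisMap cs hK hneg x ∈ D.Z cs := by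
  obtain ⟨w, k, rfl⟩ := cs.davisMk_surjective x
  exact ⟨_, ⟨mem_iUnion.2 ⟨w, _, chamberMap_mem_coneK hK hneg k, rfl⟩,
    (height_rep_chamberMap_pos cs hK hneg w k).ne'⟩, rfl⟩

theorem mem_isotropy_of_isAntidominant_rep_dot (g w : W) (k : cs.Chamber)
    (h : D.IsAntidominant (D.rep cs g (D.dot cs w (D.chamberMap cs v₀ k)))) :
    g * w ∈ cs.isotropy k := by
  rw [← parabolic_form_chamberMap_eq_isotropy hK hneg]
  exact D.mem_parabolic_of_isAntidominant_rep_dot cs (isAntidominant_chamberMap hK hneg k)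
    (by simp [height_chamberMap hK]) h

theorem davisMap_injective : Function.Injective (davisMap cs hK hneg) := by
  intro x x' h
  obtain ⟨w, k, rfl⟩ := cs.davisMk_surjective x
  obtain ⟨w', k', rfl⟩ := cs.davisMk_surjective x'
  -- translating by `w'⁻¹` reduces to the case where the second point lies in the chamber
  have h' := congrArg (D.dot cs w'⁻¹) h
  rw [← davisMap_smul, ← davisMap_smul, CoxeterSystem.smul_davisMk, CoxeterSystem.smul_davisMk,
    inv_mul_cancel] at h'
  have hone : davisMap cs hK hneg (cs.davisMk 1 k') = D.chamberMap cs v₀ k' := by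
    simp [davisMap_davisMk, dot, normalize, height_chamberMap hK]
  rw [hone] at h'
  have hmem : w'⁻¹ * w ∈ cs.isotropy k := by
    have := mem_isotropy_of_isAntidominant_rep_dot cs hK hneg 1 (w'⁻¹ * w) k (by
      rw [← davisMap_davisMk cs hK hneg, h', map_one]
      exact isAntidominant_chamberMap hK hneg k')
    rwa [one_mul] at this
  have hk : k = k' := by
    refine chamberMap_injective hK hneg ?_
    rw [← h', CoxeterSystem.davisMk_eq_iff cs |>.2 (⟨rfl, by simpa using inv_mem hmem⟩ :
      k = k ∧ (w'⁻¹ * w)⁻¹ * 1 ∈ cs.isotropy k)]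
    simp [davisMap_davisMk, dot, normalize, height_chamberMap hK]
  subst hk
  exact cs.davisMk_eq_iff.2 ⟨rfl, by simpa using inv_mem hmem⟩

variable [TopologicalSpace V] [IsTopologicalAddGroup V] [ContinuousSMul ℝ V] [T2Space V]

theorem continuous_davisMap : Continuous (davisMap cs hK hneg) := by
  have : FiniteDimensional ℝ V := Module.Finite.of_basis D.root
  refine (cs.continuous_davis_iff).2 fun w => ?_
  have h1 : Continuous fun k : cs.Chamber => D.rep cs w (D.chamberMap cs v₀ k) := by
    refine (D.rep cs w).toLinearMap.continuous_of_finiteDimensional.comp ?_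
    unfold chamberMap
    exact continuous_finsetSum _ fun T _ =>
      ((continuous_apply T).comp continuous_subtype_val).smul continuous_const
  exact ((D.height.continuous_of_finiteDimensional.comp h1).inv₀
    fun k => (height_rep_chamberMap_pos cs hK hneg w k).ne').smul h1

/-- Near the image of `[w, k]` the image of the Davis complex is covered by the images of the
finitely many chambers `w g⁻¹ K_Σ` with `g` in the finite stabiliser of `[1, k]`. -/
theorem exists_nhds_preimage_davisMap_subset (x : cs.Davis) :
    ∃ N ∈ 𝓝 (davisMap cs hK hneg x), ∃ Q, IsCompact Q ∧ davisMap cs hK hneg ⁻¹' N ⊆ Q := by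
  have : FiniteDimensional ℝ V := Module.Finite.of_basis D.root
  obtain ⟨w, k, rfl⟩ := cs.davisMk_surjective x
  have hiso := parabolic_form_chamberMap_eq_isotropy (cs := cs) hK hneg k
  have hfin := CoxeterSystem.finite_isotropy k
  obtain ⟨N, hNo, hxN, hN⟩ := D.exists_isOpen_isAntidominant_rep cs
    (isAntidominant_chamberMap hK hneg k) (by rwa [hiso])
  rw [hiso] at hN
  set h := D.height (D.rep cs w (D.chamberMap cs v₀ k)) with hh
  have hpos : 0 < h := height_rep_chamberMap_pos cs hK hneg w k
  -- `y ↦ h • w⁻¹ y` maps `w · F(k)` to `F(k)`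
  have hcont : Continuous fun y => h • D.rep cs w⁻¹ y :=
    (h • (D.rep cs w⁻¹).toLinearMap).continuous_of_finiteDimensional
  refine ⟨_, (hNo.preimage hcont).mem_nhds ?_,
    ⋃ g : cs.isotropy k, range (cs.davisMk (w * (g : W)⁻¹)),
    isCompact_iUnion fun g => isCompact_range (cs.continuous_davisMk _), fun x' hx' => ?_⟩
  · rw [mem_preimage, davisMap_davisMk, dot, normalize, ← hh, map_smul, smul_smul,
      mul_inv_cancel₀ hpos.ne', one_smul, ← LinearEquiv.mul_apply, ← map_mul, inv_mul_cancel,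
      map_one]
    exact hxN
  · obtain ⟨w', k', rfl⟩ := cs.davisMk_surjective x'
    obtain ⟨g, hg, hga⟩ := hN _ hx'
    have hmem := mem_isotropy_of_isAntidominant_rep_dot cs hK hneg (g * w⁻¹) w' k' fun s => by
      have hs := hga s
      rw [map_smul, map_smul, LinearMap.smul_apply, smul_eq_mul, davisMap_davisMk,
        ← LinearEquiv.mul_apply, ← map_mul] at hs
      exact nonpos_of_mul_nonpos_right hs hpos
    refine mem_iUnion.2 ⟨⟨g, hg⟩, k', cs.davisMk_eq_iff.2 ⟨rfl, ?_⟩⟩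
    simpa [mul_assoc] using hmem

end CoxeterDatum

theorem mainTheorem1 {B W V : Type*} [Fintype B] [Group W]
    [AddCommGroup V] [Module ℝ V] [TopologicalSpace V] [IsTopologicalAddGroup V]
    [ContinuousSMul ℝ V] [T2Space V]
    {M : CoxeterMatrix B} (cs : CoxeterSystem M W) (D : CoxeterDatum M V)
    (v₀ : V) (hv₀ : v₀ ∈ D.interiorK) :
    ∃ F : cs.Davis → D.Z cs,
      (∀ (w : W) (k : cs.Chamber),
        (F (cs.davisMk w k) : V) = D.dot cs w (D.chamberMap cs v₀ k)) ∧
      (∀ (w : W) (x : cs.Davis), (F (w • x) : V) = D.dot cs w (F x)) ∧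
      Topology.IsEmbedding F := by
  have hK := D.mem_coneK_of_mem_interiorK hv₀
  have hneg := D.form_neg_of_mem_interiorK hv₀
  exact ⟨Set.codRestrict (CoxeterDatum.davisMap cs hK hneg) (D.Z cs)
      (CoxeterDatum.davisMap_mem_Z cs hK hneg),
    CoxeterDatum.davisMap_davisMk cs hK hneg, CoxeterDatum.davisMap_smul cs hK hneg,
    (IsEmbedding.of_isCompact_preimage (CoxeterDatum.continuous_davisMap cs hK hneg)
      (CoxeterDatum.davisMap_injective cs hK hneg)
      (CoxeterDatum.exists_nhds_preimage_davisMap_subset cs hK hneg)).codRestrict _ _⟩
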